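/- For a permutation $\pi\in S_n$ and $\sigma\in S_k$, let $N_\sigma(\pi)$ be the number of index sequences $a_1<\dots<a_k$ in $\{1,\dots,n\}$ such that, for all $i,j$, $\sigma(i)<\sigma(j)$ if and only if $\pi(a_i)<\pi(a_j)$. Let $P_\sigma(\pi)=N_\sigma(\pi)/\binom nk$, and let the $k$-profile of $\pi$ be $\mathbf P_k(\pi)=(P_\sigma(\pi))_{\sigma\in S_k}\in\mathbb R^{k!}$. Write $\mathbf P_{kn}$ for the $k$-profile of a uniformly distributed random $\pi\in S_n$, and $\langle \mathbf u,\mathbf v\rangle=\sum_{\sigma\in S_k}u_\sigma v_\sigma$. For a partition $\lambda=(\lambda_1\ge\lambda_2\ge\cdots)$ of $k$, let $\rho^\lambda$ be the corresponding irreducible real representation of $S_k$: the action of $S_k$ by left multiplication on $\mathbb R[S_k]\,c_T$, where $T$ is a Young tableau of shape $\lambda$ (each of $1,\dots,k$ used once), $c_T=\big(\sum_{\sigma\in P_T}\sigma\big)\big(\sum_{\sigma\in Q_T}\mathrm{sign}(\sigma)\,\sigma\big)$, and $P_T$, $Q_T$ are the subgroups of $S_k$ that preserve the rows and the columns of $T$,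 respectively. A matrix element of $\rho^\lambda$ is a vector $(R_{ij}(\sigma))_{\sigma\in S_k}\in\mathbb R^{k!}$ formed by a fixed entry of the matrices $R(\sigma)$ of $\rho^\lambda(\sigma)$ in some basis. Let $V_r\subseteq\mathbb R^{k!}$ be the span of all matrix elements of all $\rho^\lambda$ with $\lambda$ a partition of $k$ and $\lambda_1=k-r$. **Theorem.** Let $0\le r<k$ and $\mathbf v\in V_r\setminus\{\mathbf 0\}$. Then there is a constant $C_{\mathbf v}>0$ such that $$E\big[\langle \mathbf v,\mathbf P_{kn}\rangle^2\big]\;\sim\;\frac{C_{\mathbf v}}{n^r}\qquad\text{as } n\to\infty,$$ that is, the ratio of the two sides tends to $1$. -/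

import Mathlib

open Equiv
open scoped MonoidAlgebra

namespace PermProfile

noncomputable section

/-! ### The simple representations of the symmetric group, via Young symmetrizers -/

/-- A Young tableau of shape `μ` with entries `0, …, k - 1`, each used once. It is recorded as
the bijection sending each entry to the cell (row, column) that contains it. Such a `T` exists
if and only if `μ` has exactly `k` cells, i.e. `μ` is a partition of `k`. -/
abbrev Tableau (k : ℕ) (μ : YoungDiagram) : Type := Fin k ≃ μ.cells

variable {k : ℕ} {μ : YoungDiagram}

/-- The index of the row of `T` that contains the entry `i`. -/
def Tableau.rowOf (T : Tableau k μ) (i : Fin k) : ℕ := (T i : ℕ × ℕ).1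

/-- The index of the column of `T` that contains the entry `i`. -/
def Tableau.colOf (T : Tableau k μ) (i : Fin k) : ℕ := (T i : ℕ × ℕ).2

open Classical in
/-- The sum, in the group algebra, of the permutations that preserve the rows of `T`. -/
def rowSymmetrizer (T : Tableau k μ) : ℝ[Perm (Fin k)] :=
  ∑ σ : Perm (Fin k) with ∀ i, T.rowOf (σ i) = T.rowOf i, MonoidAlgebra.of ℝ _ σ

open Classical in
/-- The signed sum, in the group algebra, of the permutations that preserve the columns
of `T`. -/
def colAntisymmetrizer (T : Tableau k μ) : ℝ[Perm (Fin k)] :=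
  ∑ σ : Perm (Fin k) with ∀ i, T.colOf (σ i) = T.colOf i,
    ((Perm.sign σ : ℤ) : ℝ) • MonoidAlgebra.of ℝ _ σ

/-- The Young symmetrizer of `T`. -/
def youngSymmetrizer (T : Tableau k μ) : ℝ[Perm (Fin k)] :=
  rowSymmetrizer T * colAntisymmetrizer T

/-- The left ideal `{x * c | x ∈ ℝ[S_k]}` generated by the Young symmetrizer `c` of `T`, as a
real vector space. -/
def youngIdeal (T : Tableau k μ) : Submodule ℝ ℝ[Perm (Fin k)] :=
  LinearMap.range (LinearMap.mulRight ℝ (youngSymmetrizer T))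

theorem leftRegular_eq_mul (σ : Perm (Fin k)) (x : ℝ[Perm (Fin k)]) :
    Representation.leftRegular ℝ (Perm (Fin k)) σ x = MonoidAlgebra.of ℝ _ σ * x := by
  induction x using MonoidAlgebra.induction_linear with
  | zero => simp
  | add f g hf hg => simp only [map_add, mul_add, hf, hg]
  | single a b => simp [Representation.ofMulAction_single, MonoidAlgebra.single_mul_single]

theorem youngIdeal_le_comap (T : Tableau k μ) (σ : Perm (Fin k)) :
    youngIdeal T ≤ (youngIdeal T).comap (Representation.leftRegular ℝ (Perm (Fin k)) σ) := by
  rintro _ ⟨x, rfl⟩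
  exact ⟨MonoidAlgebra.of ℝ _ σ * x, by simp [leftRegular_eq_mul, mul_assoc]⟩

/-- The simple representation `ρ^μ` of `S_k`: left multiplication on the left ideal generated by
a Young symmetrizer. Different tableaux `T` of the same shape `μ` give similar
representations. -/
def youngRep (T : Tableau k μ) : Representation ℝ (Perm (Fin k)) (youngIdeal T) :=
  (Representation.leftRegular ℝ (Perm (Fin k))).subrepresentation (youngIdeal T)
    (youngIdeal_le_comap T)

/-! ### Matrix elements and the subspaces `V_r` -/

/-- `f` is a matrix element of the representation `ρ` if, for some basis of the underlying space
and some `i`, `j`, `f g` is the `(i, j)` entry of the matrix of `ρ g` in that basis. -/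
def IsMatrixElement {G W : Type*} [Group G] [AddCommGroup W] [Module ℝ W]
    (ρ : Representation ℝ G W) (f : G → ℝ) : Prop :=
  ∃ (d : ℕ) (b : Module.Basis (Fin d) ℝ W) (i j : Fin d),
    ∀ g : G, f g = LinearMap.toMatrix b b (ρ g) i j

/-- The subspace `V_r` of `ℝ^{k!}`: the span of all matrix elements of the simple
representations `ρ^μ` of `S_k`, over the partitions `μ` of `k` with first part `k - r`. -/
def component (k r : ℕ) : Submodule ℝ (Perm (Fin k) → ℝ) :=
  Submodule.span ℝ {f | ∃ (μ : YoungDiagram) (T : Tableau k μ),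
    μ.rowLen 0 + r = k ∧ IsMatrixElement (youngRep T) f}

/-! ### Pattern densities and the profile -/

open Classical in
/-- The number of occurrences of the pattern `σ ∈ S_k` in `π ∈ S_n`: the number of position
sequences `a_1 < ⋯ < a_k` at which the values of `π` are ordered as those of `σ`. -/
def patternCount {k n : ℕ} (σ : Perm (Fin k)) (π : Perm (Fin n)) : ℕ :=
  Finset.card {a : Fin k → Fin n | StrictMono a ∧ ∀ i j, σ i < σ j ↔ π (a i) < π (a j)}

/-- The `k`-profile of `π ∈ S_n`: the vector of all densities of `k`-patterns in `π`. -/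
def profile (k : ℕ) {n : ℕ} (π : Perm (Fin n)) : Perm (Fin k) → ℝ :=
  fun σ => (patternCount σ π : ℝ) / (n.choose k : ℝ)

/-- The second moment `E[⟨v, P_{kn}⟩²]`, for a uniformly distributed permutation in `S_n`. -/
def secondMoment {k : ℕ} (v : Perm (Fin k) → ℝ) (n : ℕ) : ℝ :=
  (∑ π : Perm (Fin n), (∑ σ : Perm (Fin k), v σ * profile k π σ) ^ 2) / (n.factorial : ℝ)

end

end PermProfile

/-! Expanding the square of `⟨v, P_kn⟩` gives a sum over pairs of `k`-sets `A`, `B` of points. The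
expected product of the two values of `v` depends only on `m = |A ∩ B|`: it is `overlapMoment v m`.
A random pair overlaps in `m` points with probability asymptotic to a positive constant times `n ^
(-m)` (`secondMoment_eq`, `isEquivalent_choose_sub_div_choose`). So it suffices that `overlapMoment
v m` vanishes for `m < r` and is positive for `m = r`.

Let `D` label the common points and let two copies of `E` label the others. The number of orders of
the union that induce two given orders on `D ⊕ E` is an inner product of vectors attached to the two
orders (`card_merges`). Horizontal and vertical orders are independent, so `overlapSum` becomes a
sum of squares of the numbers `wordCoeff` (`overlapSum_eq_sum_sq`). These all vanish if every
`cosetSum` of `v` does, and some of them are nonzero multiples of any prescribed `cosetSum`.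

Representation theory decides which coset sums vanish. If `|E| > k - r`, two elements of `E` share a
column of any tableau with first row `k - r`, and symmetrizing over `E` kills the Young symmetrizer.
If `|E| = k - r` and all coset sums of `v` vanished, `v` would be orthogonal to all of `V_r`, hence
to itself (`exists_cosetSum_ne_zero`). -/

namespace PermProfile

/-! ### Young symmetrizers and coset sums of vectors in `V_r`. -/

section Representations

variable {k : ℕ} {μ : YoungDiagram}

/-- An element of the group algebra that annihilates the Young ideal acts on it by the zero matrix.
This turns statements about matrix elements into identities in the group algebra. -/
theorem sum_matrixElement_eq_zero {T : Tableau k μ} {f : Perm (Fin k) → ℝ}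
    (hf : IsMatrixElement (youngRep T) f) {ι : Type*} (s : Finset ι) (c : ι → ℝ)
    (g : ι → Perm (Fin k))
    (h : ∀ x, (∑ i ∈ s, c i • MonoidAlgebra.of ℝ _ (g i)) * (x * youngSymmetrizer T) = 0) :
    ∑ i ∈ s, c i * f (g i) = 0 := by
  obtain ⟨d, b, p, q, hf⟩ := hf
  have key : ∑ i ∈ s, c i • youngRep T (g i) (b q) = 0 := by
    obtain ⟨x, hx⟩ := (b q).2
    apply Subtype.ext
    rw [ZeroMemClass.coe_zero, ← h x]
    rw [LinearMap.mulRight_apply] at hx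
    simp only [AddSubmonoidClass.coe_finsetSum, SetLike.val_smul, Finset.sum_mul, smul_mul_assoc]
    refine Finset.sum_congr rfl fun i _ => ?_
    rw [hx, ← leftRegular_eq_mul]
    rfl
  have := congrArg (fun w => b.repr w p) key
  simpa [hf, LinearMap.toMatrix_apply, Finsupp.finsetSum_apply] using this

theorem mul_mul_eq_zero_of_forall_of {a c : ℝ[Perm (Fin k)]}
    (h : ∀ g, a * MonoidAlgebra.of ℝ _ g * c = 0) (x : ℝ[Perm (Fin k)]) : a * x * c = 0 := by
  induction x using MonoidAlgebra.induction_on with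
  | of g => exact h g
  | add x y hx hy => rw [mul_add, add_mul, hx, hy, add_zero]
  | smul r x hx => rw [mul_smul_comm, smul_mul_assoc, hx, smul_zero]

theorem of_swap_mul_colAntisymmetrizer (T : Tableau k μ) {i j : Fin k} (hij : i ≠ j)
    (h : T.colOf i = T.colOf j) :
    MonoidAlgebra.of ℝ _ (swap i j) * colAntisymmetrizer T = -colAntisymmetrizer T := by
  classical
  have hs : ∀ x, T.colOf (swap i j x) = T.colOf x := fun x => by
    rw [swap_apply_def]; split_ifs <;> simp_all
  unfold colAntisymmetrizer
  rw [Finset.mul_sum, ← Finset.sum_neg_distrib]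
  refine Finset.sum_equiv (Equiv.mulLeft (swap i j)) (fun σ => ?_) (fun σ _ => ?_)
  · simp [hs]
  · rw [mul_smul_comm, ← map_mul]
    simp [Perm.sign_swap hij]

theorem of_mul_rowSymmetrizer (T : Tableau k μ) {τ : Perm (Fin k)}
    (h : ∀ x, T.rowOf (τ x) = T.rowOf x) :
    MonoidAlgebra.of ℝ _ τ * rowSymmetrizer T = rowSymmetrizer T := by
  classical
  unfold rowSymmetrizer
  rw [Finset.mul_sum]
  refine Finset.sum_equiv (Equiv.mulLeft τ) (fun σ => ?_) (fun σ _ => ?_)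
  · simp [h]
  · rw [← map_mul]; rfl

theorem colOf_lt_rowLen (T : Tableau k μ) (i : Fin k) : T.colOf i < μ.rowLen 0 := by
  have h : ((T i : ℕ × ℕ).1, (T i : ℕ × ℕ).2) ∈ μ := (T i).2
  exact lt_of_lt_of_le (YoungDiagram.mem_iff_lt_rowLen.1 h) (μ.rowLen_anti _ _ (Nat.zero_le _))

variable {D E : Type*} [Fintype D] [Fintype E]

/-- With `E` placed on the first row of `T`, the permutations of `E` act inside the row group of
`T`. -/
theorem exists_arrangement_row (T : Tableau k μ) (hE : μ.rowLen 0 = Fintype.card E)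
    (hk : Fintype.card D + Fintype.card E = k) :
    ∃ α : Fin k ≃ D ⊕ E, ∀ e, T.rowOf (α.symm (Sum.inr e)) = 0 := by
  classical
  have h1 : Fintype.card {i // T.rowOf i = 0} = Fintype.card E := by
    rw [← hE, YoungDiagram.rowLen_eq_card, ← Fintype.card_coe]
    refine Fintype.card_congr ((T.subtypeEquiv (q := fun c : μ.cells => (c : ℕ × ℕ).1 = 0) ?_).trans
      ((Equiv.subtypeSubtypeEquivSubtypeInter (· ∈ μ.cells) (fun c : ℕ × ℕ => c.1 = 0)).trans
        (Equiv.subtypeEquivRight ?_)))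
    · intro i; rfl
    · intro c; simp [YoungDiagram.row]
  have h2 : Fintype.card {i // ¬ T.rowOf i = 0} = Fintype.card D := by
    rw [Fintype.card_subtype_compl, h1, Fintype.card_fin]; omega
  refine ⟨(Equiv.sumCompl fun i => T.rowOf i = 0).symm.trans ((Equiv.sumComm _ _).trans
    (Equiv.sumCongr (Fintype.equivOfCardEq h2) (Fintype.equivOfCardEq h1))), fun e => ?_⟩
  simpa using ((Fintype.equivOfCardEq h1).symm e).2

variable [DecidableEq E]

/-- The sum of `v` over a double translate of the group of permutations of `E`, acting on
`Fin k` through arrangements of `D ⊕ E`. -/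
def cosetSum (v : Perm (Fin k) → ℝ) (α β : Fin k ≃ D ⊕ E) : ℝ :=
  ∑ h : Perm E, v ((α.trans (Perm.sumCongr 1 h)).trans β.symm)

/-- A transposition of two entries from `E` is absorbed by the sum over `Perm E` on its left. If the
two entries lie in one column, it changes the sign of the column antisymmetrizer on its right. The
product thus equals its own negative. -/
theorem cosetSum_eq_zero_of_matrixElement {D : Type*} {T : Tableau k μ} {f : Perm (Fin k) → ℝ}
    (hf : IsMatrixElement (youngRep T) f) (hE : μ.rowLen 0 < Fintype.card E)
    (α β : Fin k ≃ D ⊕ E) : cosetSum f α β = 0 := by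
  classical
  unfold cosetSum
  have := sum_matrixElement_eq_zero hf Finset.univ (fun _ : Perm E => 1)
    (fun h => (α.trans (Perm.sumCongr 1 h)).trans β.symm) ?_
  · simpa using this
  intro x
  rw [youngSymmetrizer, ← mul_assoc x, ← mul_assoc]
  refine mul_mul_eq_zero_of_forall_of (fun g => ?_) _
  -- Pigeonhole: `E` has more elements than `T` has columns. The entries are pulled back through
  -- `g`, which stands between the two sums.
  obtain ⟨i, j, hij, hcol⟩ := Fintype.exists_ne_map_eq_of_card_lt
    (fun e : E => (⟨T.colOf (g⁻¹ (α.symm (Sum.inr e))), colOf_lt_rowLen T _⟩ : Fin (μ.rowLen 0)))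
    (by simpa using hE)
  set p := g⁻¹ (α.symm (Sum.inr i)) with hp
  set q := g⁻¹ (α.symm (Sum.inr j)) with hq
  have hpq : p ≠ q := by simpa [hp, hq] using hij
  have hcol : T.colOf p = T.colOf q := by simpa using hcol
  set a := ∑ h : Perm E, (1 : ℝ) • MonoidAlgebra.of ℝ (Perm (Fin k))
    ((α.trans (Perm.sumCongr 1 h)).trans β.symm) with ha
  have hswap : a * MonoidAlgebra.of ℝ _ g * MonoidAlgebra.of ℝ _ (swap p q)
      = a * MonoidAlgebra.of ℝ _ g := by
    simp only [ha, one_smul, Finset.sum_mul, ← map_mul]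
    refine Fintype.sum_equiv (Equiv.mulRight (swap i j)) _ _ fun h => ?_
    congr 1
    have h1 : g * swap p q = swap (α.symm (Sum.inr i)) (α.symm (Sum.inr j)) * g := by
      rw [Equiv.mul_swap_eq_swap_mul]; simp [hp, hq]
    rw [mul_assoc, h1, ← mul_assoc]
    congr 1
    have h2 : swap (α.symm (Sum.inr i)) (α.symm (Sum.inr j))
        = (α.trans (Perm.sumCongr 1 (swap i j))).trans α.symm := by
      rw [Perm.sumCongr_one_swap]
      exact (Equiv.symm_trans_swap_trans _ _ α.symm).symm
    rw [h2]
    ext x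
    simp [-Perm.sumCongr_one_swap]
  have : a * MonoidAlgebra.of ℝ _ g * colAntisymmetrizer T
      = -(a * MonoidAlgebra.of ℝ _ g * colAntisymmetrizer T) := by
    conv_lhs => rw [← hswap, mul_assoc, of_swap_mul_colAntisymmetrizer T hpq hcol, mul_neg]
  have h2 : (2 : ℝ) • (a * MonoidAlgebra.of ℝ _ g * colAntisymmetrizer T) = 0 := by
    rw [two_smul]
    nth_rewrite 1 [this]
    exact neg_add_cancel _
  simpa [← ha] using h2

/-- Up to the factor `|E|!`, the row symmetrizer is unchanged by left multiplication with the sum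
over permutations of `E` inside the first row. That sum can therefore be inserted next to `v`, and
the coefficients of the resulting product are coset sums of `v`. -/
theorem sum_mul_matrixElement_eq_zero {T : Tableau k μ} {f v : Perm (Fin k) → ℝ}
    (hf : IsMatrixElement (youngRep T) f) (hE : μ.rowLen 0 = Fintype.card E)
    (hk : Fintype.card D + Fintype.card E = k)
    (hv : ∀ α β : Fin k ≃ D ⊕ E, cosetSum v α β = 0) :
    ∑ g, v g * f g = 0 := by
  classical
  refine sum_matrixElement_eq_zero hf Finset.univ v id fun x => ?_
  obtain ⟨α, hα⟩ := exists_arrangement_row (D := D) T hE hk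
  set a : Perm E → Perm (Fin k) := fun h => (α.trans (Perm.sumCongr 1 h)).trans α.symm with ha
  have hrow : (∑ h, MonoidAlgebra.of ℝ _ (a h)) * rowSymmetrizer T
      = (Fintype.card (Perm E) : ℝ) • rowSymmetrizer T := by
    rw [Finset.sum_mul, Finset.sum_congr rfl fun h _ => of_mul_rowSymmetrizer T (τ := a h) ?_]
    · simp [Nat.cast_smul_eq_nsmul]
    · intro x
      obtain ⟨y | y, rfl⟩ := α.symm.surjective x
      · simp [ha]
      · simp [ha, hα]
  rw [youngSymmetrizer, ← mul_assoc x, ← mul_assoc, ← mul_assoc]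
  suffices h : (∑ g, v g • MonoidAlgebra.of ℝ _ g) * x * rowSymmetrizer T = 0 by
    simp only [id]
    rw [h, zero_mul]
  refine mul_mul_eq_zero_of_forall_of (fun g => ?_) x
  have hzero : (∑ g, v g • MonoidAlgebra.of ℝ _ g) * MonoidAlgebra.of ℝ _ g
      * ∑ h, MonoidAlgebra.of ℝ _ (a h) = 0 := by
    have : ∀ h : Perm E, (∑ g, v g • MonoidAlgebra.of ℝ _ g) * MonoidAlgebra.of ℝ _ g
        * MonoidAlgebra.of ℝ _ (a h)
        = ∑ y, v (y * a h⁻¹ * g⁻¹) • MonoidAlgebra.of ℝ _ y := by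
      intro h
      have hinv : a h⁻¹ = (a h)⁻¹ := by
        rw [eq_inv_iff_mul_eq_one]; ext x; simp [ha]
      rw [mul_assoc, ← map_mul, Finset.sum_mul]
      refine Fintype.sum_equiv (Equiv.mulRight (g * a h)) _ _ fun y => ?_
      rw [smul_mul_assoc, ← map_mul]
      simp [hinv, mul_assoc]
    rw [Finset.mul_sum, Finset.sum_congr rfl fun h _ => this h, Finset.sum_comm]
    refine Finset.sum_eq_zero fun y _ => ?_
    rw [← Finset.sum_smul]
    convert zero_smul ℝ _
    -- The coefficient of `y` is a coset sum for `α` precomposed with `g⁻¹` and with `y⁻¹`, after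
    -- replacing `h` by its inverse.
    rw [← hv ((g⁻¹ : Perm (Fin k)).trans α) ((y⁻¹ : Perm (Fin k)).trans α), cosetSum]
    refine Fintype.sum_equiv (Equiv.inv _) _ _ fun h => ?_
    congr 1
  have hc : (Fintype.card (Perm E) : ℝ) ≠ 0 := Nat.cast_ne_zero.2 Fintype.card_ne_zero
  rw [← smul_eq_zero_iff_right hc, ← mul_smul_comm, ← hrow, ← mul_assoc, hzero, zero_mul]

theorem cosetSum_eq_zero_of_mem_component {r : ℕ} {v : Perm (Fin k) → ℝ}
    (hv : v ∈ component k r) (hk : Fintype.card D + Fintype.card E = k)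
    (hr : Fintype.card D < r) (α β : Fin k ≃ D ⊕ E) : cosetSum v α β = 0 := by
  induction hv using Submodule.span_induction with
  | mem f hf =>
    obtain ⟨μ, T, hμ, hf⟩ := hf
    exact cosetSum_eq_zero_of_matrixElement hf (by omega) α β
  | zero => simp [cosetSum]
  | add f g _ _ hf hg => simp only [cosetSum, Pi.add_apply, Finset.sum_add_distrib] at *; simp [*]
  | smul c f _ hf => simp only [cosetSum, Pi.smul_apply, ← Finset.smul_sum] at *; simp [*]

/-- Otherwise `v` would be orthogonal to every matrix element spanning `V_r`, hence to itself. -/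
theorem exists_cosetSum_ne_zero {r : ℕ} {v : Perm (Fin k) → ℝ}
    (hv : v ∈ component k r) (hv0 : v ≠ 0) (hk : Fintype.card D + Fintype.card E = k)
    (hr : Fintype.card D = r) : ∃ α β : Fin k ≃ D ⊕ E, cosetSum v α β ≠ 0 := by
  by_contra! h
  have key : ∀ w ∈ component k r, ∑ g, v g * w g = 0 := by
    intro w hw
    induction hw using Submodule.span_induction with
    | mem f hf =>
      obtain ⟨μ, T, hμ, hf⟩ := hf
      exact sum_mul_matrixElement_eq_zero (D := D) (E := E) hf (by omega) hk h
    | zero => simp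
    | add f g _ _ hf hg => simp [mul_add, Finset.sum_add_distrib, hf, hg]
    | smul c f _ hf =>
      simp only [Pi.smul_apply, smul_eq_mul, mul_left_comm _ c, ← Finset.mul_sum, hf, mul_zero]
  refine hv0 (funext fun g => ?_)
  have := (Finset.sum_eq_zero_iff_of_nonneg fun g _ => mul_self_nonneg (v g)).1 (key v hv) g
    (Finset.mem_univ _)
  simpa using this

end Representations

/-! ### Counting merges of two lists as an inner product. -/

section Words

variable {D E : Type*}

/-- The formal sum of the words obtained from `w` by deleting some of its letters `none`. -/
noncomputable def deletions : List (Option D) → (List (Option D) →₀ ℝ)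
  | [] => Finsupp.single [] 1
  | some d :: w => (deletions w).mapDomain (List.cons (some d))
  | none :: w => deletions w + (deletions w).mapDomain (List.cons none)

/-- The standard inner product of finitely supported functions. -/
noncomputable def pairing {X : Type*} (f g : X →₀ ℝ) : ℝ := Finsupp.linearCombination ℝ g f

theorem pairing_add_left {X : Type*} (f f' g : X →₀ ℝ) :
    pairing (f + f') g = pairing f g + pairing f' g := map_add _ _ _

theorem pairing_comm {X : Type*} (f g : X →₀ ℝ) : pairing f g = pairing g f := by
  classical
  simp only [pairing, Finsupp.linearCombination_apply, smul_eq_mul]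
  rw [Finsupp.sum_of_support_subset f Finset.subset_union_left _ (by simp),
    Finsupp.sum_of_support_subset g Finset.subset_union_right _ (by simp)]
  exact Finset.sum_congr rfl fun _ _ => mul_comm _ _

theorem pairing_add_right {X : Type*} (f g g' : X →₀ ℝ) :
    pairing f (g + g') = pairing f g + pairing f g' := by
  rw [pairing_comm, pairing_add_left, pairing_comm g, pairing_comm g']

theorem pairing_mapDomain {X Y : Type*} {φ : X → Y} (hφ : Function.Injective φ) (f g : X →₀ ℝ) :
    pairing (f.mapDomain φ) (g.mapDomain φ) = pairing f g := by
  rw [pairing, Finsupp.linearCombination_mapDomain]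
  congr 2
  ext x
  exact Finsupp.mapDomain_apply hφ _ _

theorem pairing_mapDomain_of_ne {X Y : Type*} {φ : X → Y} (f : X →₀ ℝ) (g : Y →₀ ℝ)
    (h : ∀ x, g (φ x) = 0) : pairing (f.mapDomain φ) g = 0 := by
  rw [pairing, Finsupp.linearCombination_mapDomain, Finsupp.linearCombination_apply]
  exact Finset.sum_eq_zero fun x _ => by simp [h]

theorem pairing_mapDomain_cons_of_ne {X : Type*} {x y : X} (hxy : x ≠ y) (f g : List X →₀ ℝ) :
    pairing (f.mapDomain (List.cons x)) (g.mapDomain (List.cons y)) = 0 :=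
  pairing_mapDomain_of_ne _ _ fun l => Finsupp.mapDomain_of_notMem_range _ _ (by simp [hxy.symm])

theorem pairing_mapDomain_cons_nil {X : Type*} (x : X) (f : List X →₀ ℝ) (c : ℝ) :
    pairing (f.mapDomain (List.cons x)) (Finsupp.single [] c) = 0 :=
  pairing_mapDomain_of_ne _ _ fun l => by simp

theorem deletions_apply_of_length_lt (w s : List (Option D)) (h : w.length < s.length) :
    deletions w s = 0 := by
  induction w generalizing s with
  | nil => simp only [deletions]; rw [Finsupp.single_apply, if_neg]; rintro rfl; simp at h
  | cons a w ih =>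
    obtain _ | ⟨b, s⟩ := s
    · simp at h
    have key : ∀ x : Option D, (deletions w).mapDomain (List.cons x) (b :: s) = 0 := by
      intro x
      by_cases hx : x = b
      · rw [hx, Finsupp.mapDomain_apply (List.cons_injective)]
        exact ih _ (by simpa using h)
      · exact Finsupp.mapDomain_of_notMem_range _ _ (by simp [hx])
    cases a with
    | some d => exact key _
    | none => simp [deletions, key, ih (b :: s) (by simp at h ⊢; omega)]

/-- Only the empty deletion preserves length. This triangularity lets coset sums be read off from
`wordCoeff`. -/
theorem deletions_apply_of_length_eq [DecidableEq D] (w s : List (Option D))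
    (h : w.length = s.length) : deletions w s = if w = s then 1 else 0 := by
  induction w generalizing s with
  | nil =>
    obtain rfl : s = [] := by simpa using h.symm
    simp [deletions]
  | cons a w ih =>
    obtain _ | ⟨b, s⟩ := s
    · simp at h
    have key : (deletions w).mapDomain (List.cons a) (b :: s)
        = if a :: w = b :: s then 1 else 0 := by
      by_cases hx : a = b
      · rw [hx, Finsupp.mapDomain_apply (List.cons_injective), ih _ (by simpa using h)]
        simp
      · rw [Finsupp.mapDomain_of_notMem_range _ _ (by simp [hx]), if_neg (by simp [hx])]
    cases a with
    | some d => exact key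
    | none =>
      simp [deletions, key, deletions_apply_of_length_lt w (b :: s) (by simp at h ⊢; omega)]

/-- The word of a list over `D ⊕ E`, with every letter of `E` replaced by `none`. -/
def word (l : List (D ⊕ E)) : List (Option D) := l.map Sum.getLeft?

/-- The projection forgetting the second copy of `E`. -/
def keepFst : D ⊕ (E ⊕ E) → Option (D ⊕ E)
  | Sum.inl d => some (Sum.inl d)
  | Sum.inr (Sum.inl e) => some (Sum.inr e)
  | Sum.inr (Sum.inr _) => none

/-- The projection forgetting the first copy of `E`. -/
def keepSnd : D ⊕ (E ⊕ E) → Option (D ⊕ E)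
  | Sum.inl d => some (Sum.inl d)
  | Sum.inr (Sum.inl _) => none
  | Sum.inr (Sum.inr e) => some (Sum.inr e)

/-- The lists over `D ⊕ (E ⊕ E)` with given projections to the two copies of `D ⊕ E`. -/
def merges [DecidableEq D] [DecidableEq E] :
    List (D ⊕ E) → List (D ⊕ E) → Finset (List (D ⊕ (E ⊕ E)))
  | [], [] => {[]}
  | Sum.inr e :: l, [] => (merges l []).map ⟨List.cons (Sum.inr (Sum.inl e)), List.cons_injective⟩
  | Sum.inl _ :: _, [] => ∅
  | [], Sum.inr e :: l => (merges [] l).map ⟨List.cons (Sum.inr (Sum.inr e)), List.cons_injective⟩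
  | [], Sum.inl _ :: _ => ∅
  | Sum.inl d :: l, Sum.inl d' :: l' =>
    if d = d' then (merges l l').map ⟨List.cons (Sum.inl d), List.cons_injective⟩ else ∅
  | Sum.inr e :: l, Sum.inl d' :: l' =>
    (merges l (Sum.inl d' :: l')).map ⟨List.cons (Sum.inr (Sum.inl e)), List.cons_injective⟩
  | Sum.inl d :: l, Sum.inr e' :: l' =>
    (merges (Sum.inl d :: l) l').map ⟨List.cons (Sum.inr (Sum.inr e')), List.cons_injective⟩
  | Sum.inr e :: l, Sum.inr e' :: l' =>
    (merges l (Sum.inr e' :: l')).map ⟨List.cons (Sum.inr (Sum.inl e)), List.cons_injective⟩ ∪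
      (merges (Sum.inr e :: l) l').map ⟨List.cons (Sum.inr (Sum.inr e')), List.cons_injective⟩
termination_by l l' => l.length + l'.length

variable [DecidableEq D] [DecidableEq E]

theorem mem_merges (l l' : List (D ⊕ E)) (s : List (D ⊕ (E ⊕ E))) :
    s ∈ merges l l' ↔ s.filterMap keepFst = l ∧ s.filterMap keepSnd = l' := by
  induction s generalizing l l' with
  | nil =>
    obtain _ | ⟨_ | _, l⟩ := l <;> obtain _ | ⟨_ | _, l'⟩ := l' <;> simp [merges]
    split_ifs <;> simp
  | cons x s ih =>
    obtain _ | ⟨_ | _, l⟩ := l <;> obtain _ | ⟨_ | _, l'⟩ := l' <;>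
      obtain _ | _ | _ := x <;> simp [merges, keepFst, keepSnd, ih, List.filterMap_cons,
        -List.filterMap_eq_nil_iff]
    all_goals first | grind | (split_ifs <;> simp [ih] <;> grind)

/-- Between consecutive letters of `D`, blocks of `a` and `b` letters of `E` interleave in `C(a+b,
a) = ∑ j, C(a, j) C(b, j)` ways (Vandermonde), and `C(a, j)` counts the deletions that leave `j`
letters. If the letters of `D` come in different orders, both sides are zero. The induction proves
this letter by letter. -/
theorem card_merges (l l' : List (D ⊕ E)) :
    ((merges l l').card : ℝ) = pairing (deletions (word l)) (deletions (word l')) := by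
  induction l, l' using merges.induct with
  | case1 => simp [merges, word, deletions, pairing]
  | case2 e l ih =>
    simp only [word] at ih
    simp [merges, word, deletions, ih, pairing_add_left, pairing_mapDomain_cons_nil]
  | case3 d l => simp [merges, word, deletions, pairing_mapDomain_cons_nil]
  | case4 e l ih =>
    simp only [word] at ih
    rw [pairing_comm] at ih ⊢
    simp [merges, word, deletions, ih, pairing_add_left, pairing_mapDomain_cons_nil]
  | case5 d l =>
    rw [pairing_comm]
    simp [merges, word, deletions, pairing_mapDomain_cons_nil]
  | case6 d l l' ih =>
    simp only [word] at ih
    simp [merges, word, deletions, ih, pairing_mapDomain List.cons_injective]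
  | case7 d l d' l' h =>
    simp [merges, word, deletions, h, pairing_mapDomain_cons_of_ne]
  | case8 e l d l' ih =>
    simp only [word] at ih
    simp [merges, word, deletions, ih, pairing_add_left, pairing_mapDomain_cons_of_ne]
  | case9 d l e l' ih =>
    simp only [word] at ih
    simp [merges, word, deletions, ih, pairing_add_right, pairing_mapDomain_cons_of_ne]
  | case10 e l e' l' ih ih' =>
    simp only [word] at ih ih'
    rw [merges, Finset.card_union_of_disjoint]
    · simp [word, deletions, ih, ih', pairing_add_right, pairing_add_left,
        pairing_mapDomain List.cons_injective]
      ring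
    · simp [Finset.disjoint_left]

end Words

/-! ### The overlap sum as a sum of squares. -/

section Orders

/-- The filtered list is always sorted by position in `s` and contains each label once, and such a
list is unique. -/
theorem filterMap_ofFn_eq_iff {I U : Type*} {k N : ℕ} (s : Fin N ≃ U) {keep : U → Option I}
    {j : I → U} (hj : ∀ u i, keep u = some i ↔ j i = u) (α : Fin k ≃ I) :
    (List.ofFn s).filterMap keep = List.ofFn α ↔ StrictMono (s.symm ∘ j ∘ α) := by
  have hpw : ((List.ofFn s).filterMap keep).Pairwise fun a b => s.symm (j a) < s.symm (j b) := by
    rw [List.pairwise_filterMap, List.pairwise_ofFn]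
    intro a b hab x hx y hy
    rw [(hj _ _).1 hx, (hj _ _).1 hy]
    simpa using hab
  constructor
  · intro h
    rw [h, List.pairwise_ofFn] at hpw
    exact fun a b hab => hpw hab
  · intro h
    have hpw' : (List.ofFn α).Pairwise fun a b => s.symm (j a) < s.symm (j b) :=
      List.pairwise_ofFn.2 fun a b hab => h hab
    refine List.Perm.eq_of_pairwise (fun a b _ _ h h' => absurd h (lt_asymm h')) hpw hpw' ?_
    refine (List.perm_ext_iff_of_nodup (hpw.imp fun {a b} h => ?_)
      (hpw'.imp fun {a b} h => ?_)).2 fun i => ?_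
    · rintro rfl; exact lt_irrefl _ h
    · rintro rfl; exact lt_irrefl _ h
    · simp only [List.mem_filterMap, List.mem_ofFn, hj]
      exact ⟨fun _ => α.surjective i, fun _ => ⟨j i, s.surjective _, rfl⟩⟩

theorem exists_ofFn_eq {U : Type*} {N : ℕ} [Fintype U] [DecidableEq U]
    (hN : Fintype.card U = N) {l : List U} (hl : ∀ u, l.count u = 1) :
    ∃ s : Fin N ≃ U, List.ofFn s = l := by
  have hnd : l.Nodup := List.nodup_iff_count_le_one.2 fun u => (hl u).le
  have hmem : ∀ u, u ∈ l := fun u => List.count_pos_iff.1 (by rw [hl]; exact one_pos)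
  have hlen : l.length = N := by
    rw [← hN, ← List.toFinset_card_of_nodup hnd, ← Finset.card_univ]
    congr 1
    ext u
    simp [hmem]
  subst hlen
  exact ⟨hnd.getEquivOfForallMemList l hmem, List.ofFn_get l⟩

variable {D E : Type*}

theorem keepFst_eq_some_iff (u : D ⊕ (E ⊕ E)) (i : D ⊕ E) :
    keepFst u = some i ↔ Sum.map id Sum.inl i = u := by
  obtain _ | _ | _ := u <;> obtain _ | _ := i <;> simp [keepFst, eq_comm]

theorem keepSnd_eq_some_iff (u : D ⊕ (E ⊕ E)) (i : D ⊕ E) :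
    keepSnd u = some i ↔ Sum.map id Sum.inr i = u := by
  obtain _ | _ | _ := u <;> obtain _ | _ := i <;> simp [keepSnd, eq_comm]

theorem word_trans_sumCongr {k : ℕ} (α : Fin k ≃ D ⊕ E) (h : Perm E) :
    word (List.ofFn (α.trans (Perm.sumCongr 1 h))) = word (List.ofFn α) := by
  simp only [word, List.map_ofFn]
  congr 1
  ext x : 1
  simp only [Function.comp_apply, Equiv.trans_apply]
  cases α x <;> simp

variable [Fintype D] [Fintype E] [DecidableEq D] [DecidableEq E] {k N : ℕ}

theorem count_eq_one_of_filterMap {I U : Type*} [DecidableEq U] [DecidableEq I]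
    {keep : U → Option I}
    {j : I → U} (hj : ∀ u i, keep u = some i ↔ j i = u) {l : List U} {α : Fin k ≃ I}
    (h : l.filterMap keep = List.ofFn α) (i : I) : l.count (j i) = 1 := by
  have h1 : (List.ofFn α).count i = 1 :=
    List.count_eq_one_of_mem (List.nodup_ofFn.2 α.injective) (by simp [α.surjective i])
  rw [← h1, ← h, List.count_filterMap, List.count_eq_countP]
  refine List.countP_congr fun u _ => ?_
  rw [beq_iff_eq, beq_iff_eq, hj, eq_comm]

open Classical in
theorem card_orders_eq_pairing (hN : Fintype.card (D ⊕ (E ⊕ E)) = N) (α α' : Fin k ≃ D ⊕ E) :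
    (Finset.card {s : Fin N ≃ D ⊕ (E ⊕ E) | StrictMono (s.symm ∘ Sum.map id Sum.inl ∘ α) ∧
      StrictMono (s.symm ∘ Sum.map id Sum.inr ∘ α')} : ℝ) =
    pairing (deletions (word (List.ofFn α))) (deletions (word (List.ofFn α'))) := by
  rw [← card_merges]
  congr 1
  refine Finset.card_bij (fun s _ => List.ofFn s) ?_ ?_ ?_
  · intro s hs
    rw [mem_merges, filterMap_ofFn_eq_iff s keepFst_eq_some_iff,
      filterMap_ofFn_eq_iff s keepSnd_eq_some_iff]
    simpa using hs
  · intro s _ t _ h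
    exact DFunLike.coe_injective (List.ofFn_injective h)
  · intro l hl
    obtain ⟨h1, h2⟩ := (mem_merges _ _ _).1 hl
    have hcount : ∀ u, @List.count _ instBEqOfDecidableEq u l = 1 := by
      rintro (d | e | e)
      · exact count_eq_one_of_filterMap keepFst_eq_some_iff h1 (Sum.inl d)
      · exact count_eq_one_of_filterMap keepFst_eq_some_iff h1 (Sum.inr e)
      · exact count_eq_one_of_filterMap keepSnd_eq_some_iff h2 (Sum.inr e)
    obtain ⟨s, rfl⟩ := exists_ofFn_eq hN hcount
    refine ⟨s, ?_, rfl⟩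
    rw [filterMap_ofFn_eq_iff s keepFst_eq_some_iff] at h1
    rw [filterMap_ofFn_eq_iff s keepSnd_eq_some_iff] at h2
    simp [h1, h2]

open Classical in
/-- The value of `v` at the pattern formed by a family of points with coordinates `p i`, `q i`. -/
noncomputable def patternValue {I X Y : Type*} [Fintype I] [DecidableEq I] [LinearOrder X]
    [LinearOrder Y] (v : Perm (Fin k) → ℝ) (p : I → X) (q : I → Y) : ℝ :=
  ∑ s : Fin k ≃ I, ∑ t : Fin k ≃ I,
    if StrictMono (p ∘ s) ∧ StrictMono (q ∘ t) then v (s.trans t.symm) else 0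

variable (D E N) in
/-- The sum over pairs of orders of `D ⊕ (E ⊕ E)` of the products of the values of `v` at the
patterns of the two copies of `D ⊕ E`. -/
noncomputable def overlapSum (v : Perm (Fin k) → ℝ) : ℝ :=
  ∑ s : Fin N ≃ D ⊕ (E ⊕ E), ∑ t : Fin N ≃ D ⊕ (E ⊕ E),
    patternValue v (s.symm ∘ Sum.map id Sum.inl) (t.symm ∘ Sum.map id Sum.inl) *
      patternValue v (s.symm ∘ Sum.map id Sum.inr) (t.symm ∘ Sum.map id Sum.inr)

/-- The coefficients of the decomposition of `overlapSum` into squares. -/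
noncomputable def wordCoeff (v : Perm (Fin k) → ℝ) (S S' : List (Option D)) : ℝ :=
  ∑ α : Fin k ≃ D ⊕ E, ∑ β : Fin k ≃ D ⊕ E, deletions (word (List.ofFn α)) S *
    deletions (word (List.ofFn β)) S' * v (α.trans β.symm)

variable (D E k) in
/-- All words obtained by deleting letters from words of arrangements. -/
noncomputable def wordSupport : Finset (List (Option D)) :=
  Finset.univ.biUnion fun α : Fin k ≃ D ⊕ E => (deletions (word (List.ofFn α))).support

theorem pairing_eq_sum_wordSupport (α β : Fin k ≃ D ⊕ E) :
    pairing (deletions (word (List.ofFn α))) (deletions (word (List.ofFn β))) =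
      ∑ S ∈ wordSupport D E k, deletions (word (List.ofFn α)) S *
        deletions (word (List.ofFn β)) S := by
  rw [pairing, Finsupp.linearCombination_apply]
  exact Finsupp.sum_of_support_subset _ (Finset.subset_biUnion_of_mem
    (fun α : Fin k ≃ D ⊕ E => (deletions (word (List.ofFn α))).support) (Finset.mem_univ α)) _
    (by simp)

/-- The orders `s` and `t` are summed independently, each giving a `pairing`. Expanding both
pairings over words `S`, `S'` separates the data of the first copy of `D ⊕ E` from that of the
second, and the two factors coincide. -/
theorem overlapSum_eq_sum_sq (hN : Fintype.card (D ⊕ (E ⊕ E)) = N) (v : Perm (Fin k) → ℝ) :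
    overlapSum D E N v = ∑ S ∈ wordSupport D E k, ∑ S' ∈ wordSupport D E k,
      wordCoeff (E := E) v S S' ^ 2 := by
  classical
  have h1 : overlapSum D E N v = ∑ α : Fin k ≃ D ⊕ E, ∑ α' : Fin k ≃ D ⊕ E,
      ∑ β : Fin k ≃ D ⊕ E, ∑ β' : Fin k ≃ D ⊕ E, v (α.trans β.symm) * v (α'.trans β'.symm) *
      (pairing (deletions (word (List.ofFn α))) (deletions (word (List.ofFn α'))) *
       pairing (deletions (word (List.ofFn β))) (deletions (word (List.ofFn β')))) := by
    simp only [← card_orders_eq_pairing hN, Finset.card_filter, Nat.cast_sum, Finset.sum_mul_sum,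
      overlapSum, patternValue]
    rw [← Fintype.sum_prod_type']
    rw [Finset.sum_comm]
    refine Finset.sum_congr rfl fun α _ => ?_
    rw [Finset.sum_comm]
    refine Finset.sum_congr rfl fun α' _ => ?_
    rw [Finset.sum_comm]
    refine Finset.sum_congr rfl fun β _ => ?_
    rw [Finset.sum_comm]
    refine Finset.sum_congr rfl fun β' _ => ?_
    simp only [Finset.mul_sum]
    rw [Fintype.sum_prod_type]
    refine Finset.sum_congr rfl fun s _ => Finset.sum_congr rfl fun t _ => ?_
    simp only [Function.comp_assoc]
    by_cases h1 : StrictMono (s.symm ∘ Sum.map id Sum.inl ∘ α) <;>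
    by_cases h2 : StrictMono (s.symm ∘ Sum.map id Sum.inr ∘ α') <;>
    by_cases h3 : StrictMono (t.symm ∘ Sum.map id Sum.inl ∘ β) <;>
    by_cases h4 : StrictMono (t.symm ∘ Sum.map id Sum.inr ∘ β') <;>
    simp [h1, h2, h3, h4]
  have h2 : ∀ S S', wordCoeff (E := E) v S S' ^ 2 = ∑ α : Fin k ≃ D ⊕ E, ∑ α' : Fin k ≃ D ⊕ E,
      ∑ β : Fin k ≃ D ⊕ E, ∑ β' : Fin k ≃ D ⊕ E, v (α.trans β.symm) * v (α'.trans β'.symm) *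
      (deletions (word (List.ofFn α)) S * deletions (word (List.ofFn α')) S *
       (deletions (word (List.ofFn β)) S' * deletions (word (List.ofFn β')) S')) := by
    intro S S'
    simp only [sq, wordCoeff, Finset.sum_mul_sum]
    refine Finset.sum_congr rfl fun α _ => Finset.sum_congr rfl fun α' _ =>
      Finset.sum_congr rfl fun β _ => Finset.sum_congr rfl fun β' _ => by ring
  rw [h1]
  simp only [h2]
  rw [← Finset.sum_product' (wordSupport D E k) (wordSupport D E k)]
  symm
  rw [Finset.sum_comm]
  refine Finset.sum_congr rfl fun α _ => ?_
  rw [Finset.sum_comm]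
  refine Finset.sum_congr rfl fun α' _ => ?_
  rw [Finset.sum_comm]
  refine Finset.sum_congr rfl fun β _ => ?_
  rw [Finset.sum_comm]
  refine Finset.sum_congr rfl fun β' _ => ?_
  rw [pairing_eq_sum_wordSupport, pairing_eq_sum_wordSupport, Finset.sum_mul_sum, ← Finset.mul_sum,
    Finset.sum_product]

/-- Two arrangements have the same word exactly when they differ by a permutation of `E`. -/
theorem sum_word_eq (α₀ : Fin k ≃ D ⊕ E) (g : (Fin k ≃ D ⊕ E) → ℝ) :
    ∑ α : Fin k ≃ D ⊕ E, (if word (List.ofFn α) = word (List.ofFn α₀) then (1 : ℝ) else 0) * g α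
      = ∑ h : Perm E, g (α₀.trans (Perm.sumCongr 1 h)) := by
  simp only [ite_mul, one_mul, zero_mul]
  rw [← Finset.sum_filter]
  symm
  refine Finset.sum_bij (fun h _ => α₀.trans (Perm.sumCongr 1 h)) ?_ ?_ ?_ (fun _ _ => rfl)
  · intro h _
    simp only [word, List.map_ofFn, Finset.mem_filter, Finset.mem_univ, true_and]
    congr 1
    ext x : 1
    simp only [Function.comp_apply, Equiv.trans_apply]
    cases α₀ x <;> simp
  · intro h _ h' _ hh
    ext e
    have := Equiv.congr_fun hh (α₀.symm (Sum.inr e))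
    simpa using this
  · intro α hα
    simp only [word, List.map_ofFn, Finset.mem_filter, Finset.mem_univ, true_and] at hα
    have hα := congrFun (List.ofFn_injective hα)
    set τ : Perm (D ⊕ E) := α₀.symm.trans α with hτ
    have hfix : ∀ d, τ (Sum.inl d) = Sum.inl d := by
      intro d
      have := hα (α₀.symm (Sum.inl d))
      simp only [Function.comp_apply, Equiv.apply_symm_apply] at this
      rwa [Sum.getLeft?_inl, Sum.getLeft?_eq_some_iff] at this
    obtain ⟨⟨e, h⟩, hh⟩ := Perm.mem_sumCongrHom_range_of_perm_mapsTo_inl (σ := τ) (by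
      rintro _ ⟨d, rfl⟩; exact ⟨d, (hfix d).symm⟩)
    refine ⟨h, Finset.mem_univ _, ?_⟩
    have he : e = 1 := by
      ext d
      have := hfix d
      rw [← hh] at this
      simpa using this
    subst he
    rw [Perm.sumCongrHom_apply] at hh
    rw [hh, hτ]
    ext x; simp

/-- Words do not see permutations of `E`, so the sum over `α` may be averaged over `Perm E`, and
coset sums of `v` appear. -/
theorem wordCoeff_eq_zero {v : Perm (Fin k) → ℝ}
    (hv : ∀ α β : Fin k ≃ D ⊕ E, cosetSum v α β = 0) (S S' : List (Option D)) :
    wordCoeff (E := E) v S S' = 0 := by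
  rw [wordCoeff, Finset.sum_comm]
  refine Finset.sum_eq_zero fun β _ => ?_
  have hc : (Fintype.card (Perm E) : ℝ) ≠ 0 := Nat.cast_ne_zero.2 Fintype.card_ne_zero
  refine (mul_eq_zero_iff_left hc).1 ?_
  rw [← nsmul_eq_mul, ← Finset.card_univ, ← Finset.sum_const]
  have : ∀ h : Perm E, ∑ α : Fin k ≃ D ⊕ E, deletions (word (List.ofFn α)) S *
      deletions (word (List.ofFn β)) S' * v (α.trans β.symm) =
      ∑ α : Fin k ≃ D ⊕ E, deletions (word (List.ofFn α)) S *
      deletions (word (List.ofFn β)) S' * v ((α.trans (Perm.sumCongr 1 h)).trans β.symm) := by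
    intro h
    refine (Fintype.sum_equiv ((Equiv.refl _).equivCongr (Perm.sumCongr 1 h)) _ _ fun α => ?_).symm
    change _ = deletions (word (List.ofFn (α.trans (Perm.sumCongr 1 h)))) S * _ * _
    rw [word_trans_sumCongr]
    rfl
  rw [Finset.sum_congr rfl fun h _ => this h, Finset.sum_comm]
  refine Finset.sum_eq_zero fun α _ => ?_
  rw [← Finset.mul_sum]
  exact mul_eq_zero_of_right _ (hv α β)

theorem wordCoeff_word (v : Perm (Fin k) → ℝ) (α β : Fin k ≃ D ⊕ E) :
    wordCoeff (E := E) v (word (List.ofFn α)) (word (List.ofFn β)) =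
      Fintype.card (Perm E) * cosetSum v α β := by
  have hd : ∀ α β : Fin k ≃ D ⊕ E, deletions (word (List.ofFn α)) (word (List.ofFn β)) =
      if word (List.ofFn α) = word (List.ofFn β) then 1 else 0 := fun α β =>
    deletions_apply_of_length_eq _ _ (by simp [word])
  simp only [wordCoeff, hd, mul_assoc, ← Finset.mul_sum]
  rw [sum_word_eq α fun α' => ∑ β' : Fin k ≃ D ⊕ E,
    (if word (List.ofFn β') = word (List.ofFn β) then 1 else 0) * v (α'.trans β'.symm)]
  simp only [sum_word_eq β fun β' => v ((α.trans (Perm.sumCongr 1 _)).trans β'.symm)]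
  rw [Finset.sum_comm, ← nsmul_eq_mul, ← Finset.card_univ, ← Finset.sum_const]
  refine Finset.sum_congr rfl fun h _ => ?_
  -- `v` sees only `h⁻¹ * h'`, so one of the two sums over `Perm E` just contributes the factor
  -- `|E|!`.
  refine Fintype.sum_equiv (Equiv.mulLeft h⁻¹) _ _ fun h' => ?_
  congr 1
  ext x
  simp only [Equiv.trans_apply, Equiv.symm_trans_apply, Equiv.coe_mulLeft]
  cases α x
  · simp only [Perm.sumCongr_apply, Sum.map_inl, Perm.coe_one]
    rfl
  · simp

theorem overlapSum_eq_zero (hN : Fintype.card (D ⊕ (E ⊕ E)) = N) {v : Perm (Fin k) → ℝ}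
    (hv : ∀ α β : Fin k ≃ D ⊕ E, cosetSum v α β = 0) : overlapSum D E N v = 0 := by
  simp [overlapSum_eq_sum_sq hN, wordCoeff_eq_zero hv]

theorem overlapSum_pos (hN : Fintype.card (D ⊕ (E ⊕ E)) = N) {v : Perm (Fin k) → ℝ}
    {α β : Fin k ≃ D ⊕ E} (hv : cosetSum v α β ≠ 0) : 0 < overlapSum D E N v := by
  have hmem : ∀ α : Fin k ≃ D ⊕ E, word (List.ofFn α) ∈ wordSupport D E k := fun α =>
    Finset.mem_biUnion.2 ⟨α, Finset.mem_univ _, by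
      simp [deletions_apply_of_length_eq]⟩
  have hpos : 0 < wordCoeff (E := E) v (word (List.ofFn α)) (word (List.ofFn β)) ^ 2 := by
    rw [wordCoeff_word]
    have hc : (Fintype.card (Perm E) : ℝ) ≠ 0 := Nat.cast_ne_zero.2 Fintype.card_ne_zero
    positivity
  rw [overlapSum_eq_sum_sq hN]
  refine Finset.sum_pos' (fun S _ => Finset.sum_nonneg fun S' _ => sq_nonneg _)
    ⟨_, hmem α, Finset.sum_pos' (fun S' _ => sq_nonneg _) ⟨_, hmem β, hpos⟩⟩

end Orders

/-! ### From the second moment to overlap sums. -/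

section Sorting

theorem sorting_unique {I X : Type*} [LinearOrder X] {N : ℕ} {p : I → X} {s t : Fin N ≃ I}
    (hs : StrictMono (p ∘ s)) (ht : StrictMono (p ∘ t)) : s = t := by
  have hp : Function.Injective p := fun a b hab => by
    have : (p ∘ s) (s.symm a) = (p ∘ s) (s.symm b) := by simpa using hab
    simpa using hs.injective this
  have := (hs.range_inj ht).1 (by simp [Set.range_comp])
  exact DFunLike.coe_injective (funext fun i => hp (congrFun this i))

theorem exists_sorting {I X : Type*} [Fintype I] [LinearOrder X] {N : ℕ}
    (hN : Fintype.card I = N) {p : I → X} (hp : Function.Injective p) :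
    ∃ s : Fin N ≃ I, StrictMono (p ∘ s) := by
  let e : Fin N ≃ I := (Fintype.equivFinOfCardEq hN).symm
  refine ⟨(Tuple.sort (p ∘ e)).trans e, ?_⟩
  exact (Tuple.monotone_sort (p ∘ e)).strictMono_of_injective
    (hp.comp ((Tuple.sort (p ∘ e)).trans e).injective)

open Classical in
theorem sum_sorting {I X : Type*} [Fintype I] [DecidableEq I] [LinearOrder X] {N : ℕ}
    (hN : Fintype.card I = N) {p : I → X} (hp : Function.Injective p) :
    ∑ s : Fin N ≃ I, (if StrictMono (p ∘ s) then (1 : ℝ) else 0) = 1 := by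
  obtain ⟨s, hs⟩ := exists_sorting hN hp
  rw [Finset.sum_eq_single s (fun t _ hts => if_neg fun ht => hts (sorting_unique ht hs))
    (by simp), if_pos hs]

variable {I X Y : Type*} [Fintype I] [DecidableEq I] [LinearOrder X] [LinearOrder Y] {k n : ℕ}

theorem patternValue_comp_equiv {J : Type*} [Fintype J] [DecidableEq J] (v : Perm (Fin k) → ℝ)
    (p : I → X) (q : I → Y) (τ : J ≃ I) :
    patternValue v (p ∘ τ) (q ∘ τ) = patternValue v p q := by
  refine Fintype.sum_equiv ((Equiv.refl _).equivCongr τ) _ _ fun s =>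
    Fintype.sum_equiv ((Equiv.refl _).equivCongr τ) _ _ fun t => ?_
  have h : (s.trans τ).trans (t.trans τ).symm = s.trans t.symm := by ext; simp
  change _ = if StrictMono (p ∘ (s.trans τ)) ∧ StrictMono (q ∘ (t.trans τ)) then
    v ((s.trans τ).trans (t.trans τ).symm) else 0
  rw [h]
  rfl

theorem patternValue_strictMono_comp {X' Y' : Type*} [LinearOrder X'] [LinearOrder Y']
    (v : Perm (Fin k) → ℝ) (p : I → X) (q : I → Y) {f : X → X'} {g : Y → Y'}
    (hf : StrictMono f) (hg : StrictMono g) :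
    patternValue v (f ∘ p) (g ∘ q) = patternValue v p q := by
  have h1 : ∀ s : Fin k ≃ I, StrictMono ((f ∘ p) ∘ s) ↔ StrictMono (p ∘ s) := fun s =>
    ⟨fun h a b hab => hf.lt_iff_lt.1 (h hab), fun h a b hab => hf (h hab)⟩
  have h2 : ∀ s : Fin k ≃ I, StrictMono ((g ∘ q) ∘ s) ↔ StrictMono (q ∘ s) := fun s =>
    ⟨fun h a b hab => hg.lt_iff_lt.1 (h hab), fun h a b hab => hg (h hab)⟩
  simp only [patternValue, h1, h2]

open Classical in
theorem sum_mul_ite_eq_patternValue (v : Perm (Fin k) → ℝ) {a : Fin k → Fin n}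
    (ha : StrictMono a) (π : Perm (Fin n)) :
    ∑ σ, v σ * (if ∀ i j, σ i < σ j ↔ π (a i) < π (a j) then 1 else 0) =
      patternValue v a (π ∘ a) := by
  have hs : ∀ s : Fin k ≃ Fin k, StrictMono (a ∘ s) ↔ s = Equiv.refl _ := fun s =>
    ⟨fun h => sorting_unique h (t := Equiv.refl _) ha, fun h => by rw [h]; exact ha⟩
  rw [patternValue, Finset.sum_comm]
  refine Fintype.sum_equiv (Equiv.inv _) _ _ fun σ => ?_
  have hσ : (∀ i j, σ i < σ j ↔ π (a i) < π (a j)) ↔ StrictMono ((π ∘ a) ∘ (σ⁻¹ : Perm _)) := by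
    constructor
    · intro h x y hxy
      exact (h _ _).1 (by simpa using hxy)
    · intro h i j
      rw [← h.lt_iff_lt]
      simp
  simp only [hs, ite_and, Finset.sum_ite_eq', Finset.mem_univ, if_true, hσ, mul_ite, mul_one,
    mul_zero]
  rfl

/-- The value of `v` at the pattern formed by the points with labels in `A`. -/
noncomputable def setValue (v : Perm (Fin k) → ℝ) (A : Finset (Fin n)) (π₁ π₂ : Perm (Fin n)) :
    ℝ :=
  patternValue v (fun i : A => π₁ i) (fun i : A => π₂ i)

theorem sum_mul_patternCount (v : Perm (Fin k) → ℝ) (π : Perm (Fin n)) :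
    ∑ σ, v σ * patternCount σ π =
      ∑ A ∈ Finset.powersetCard k Finset.univ, setValue v A 1 π := by
  classical
  have h1 : ∑ σ, v σ * patternCount σ π =
      ∑ a : Fin k → Fin n with StrictMono a, patternValue v a (π ∘ a) := by
    rw [Finset.sum_congr rfl fun a ha =>
      (sum_mul_ite_eq_patternValue v (Finset.mem_filter.1 ha).2 π).symm, Finset.sum_comm]
    refine Finset.sum_congr rfl fun σ _ => ?_
    rw [← Finset.mul_sum, patternCount, ← Finset.filter_filter, Finset.card_filter, Nat.cast_sum]
    congr 1
    refine Finset.sum_congr rfl fun a _ => ?_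
    split_ifs <;> simp
  rw [h1]
  symm
  refine Finset.sum_bij (fun A hA => A.orderEmbOfFin (Finset.mem_powersetCard.1 hA).2)
    ?_ ?_ ?_ ?_
  · intro A hA
    simpa using (A.orderEmbOfFin _).strictMono
  · intro A hA B hB h
    have := congrArg Set.range h
    simpa using this
  · intro a ha
    have ha : StrictMono a := by simpa using ha
    refine ⟨Finset.univ.image a, ?_, ?_⟩
    · simp [Finset.mem_powersetCard, Finset.card_image_of_injective _ ha.injective]
    · exact (Finset.orderEmbOfFin_unique _ (by simp) ha).symm
  · intro A hA
    have hA := (Finset.mem_powersetCard.1 hA).2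
    rw [setValue, ← patternValue_comp_equiv v _ _ (A.orderIsoOfFin hA).toEquiv]
    rfl

/-- Writing a permutation as `π₂ * π₁⁻¹` gives point `i` the coordinates `π₁ i` and `π₂ i`. With
both factors uniform, the two coordinate orders become independent and play symmetric roles. -/
theorem sum_setValue_mul_inv (v : Perm (Fin k) → ℝ) (π₁ π₂ : Perm (Fin n)) :
    ∑ A ∈ Finset.powersetCard k Finset.univ, setValue v A 1 (π₂ * π₁⁻¹) =
      ∑ A ∈ Finset.powersetCard k Finset.univ, setValue v A π₁ π₂ := by
  symm
  refine Finset.sum_equiv π₁.finsetCongr (fun A => ?_) (fun A _ => ?_)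
  · simp [Finset.mem_powersetCard]
  · rw [setValue, setValue,
      ← patternValue_comp_equiv v _ _ (π₁.subtypeEquiv
        (p := (· ∈ A)) (q := (· ∈ π₁.finsetCongr A)) (by simp))]
    congr 1
    ext i
    exact congrArg (fun x => (π₂ x : ℕ)) (π₁.symm_apply_apply i).symm

theorem sum_sq_sum_setValue (v : Perm (Fin k) → ℝ) (n : ℕ) :
    (n.factorial : ℝ) * ∑ π : Perm (Fin n),
      (∑ A ∈ Finset.powersetCard k Finset.univ, setValue v A 1 π) ^ 2 =
    ∑ A ∈ Finset.powersetCard k Finset.univ, ∑ B ∈ Finset.powersetCard k Finset.univ,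
      ∑ π₁ : Perm (Fin n), ∑ π₂ : Perm (Fin n), setValue v A π₁ π₂ * setValue v B π₁ π₂ := by
  have h : ∀ π₁ : Perm (Fin n), ∑ π : Perm (Fin n),
      (∑ A ∈ Finset.powersetCard k Finset.univ, setValue v A 1 π) ^ 2 =
      ∑ π₂ : Perm (Fin n), (∑ A ∈ Finset.powersetCard k Finset.univ, setValue v A π₁ π₂) ^ 2 := by
    intro π₁
    symm
    refine Fintype.sum_equiv (Equiv.mulRight π₁⁻¹) _ _ fun π₂ => ?_
    rw [Equiv.coe_mulRight, sum_setValue_mul_inv]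
  have h2 : (n.factorial : ℝ) = Fintype.card (Perm (Fin n)) := by
    rw [Fintype.card_perm, Fintype.card_fin]
  rw [h2, ← nsmul_eq_mul, ← Finset.card_univ, ← Finset.sum_const,
    Finset.sum_congr rfl fun π₁ _ => h π₁]
  simp only [sq, Finset.sum_mul_sum]
  rw [← Fintype.sum_prod_type', Finset.sum_comm]
  refine Finset.sum_congr rfl fun A _ => ?_
  rw [Finset.sum_comm]
  refine Finset.sum_congr rfl fun B _ => ?_
  rw [Fintype.sum_prod_type]

-- By symmetry all `N!` relative orders of the labels are equally frequent, and each permutation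
-- induces exactly one of them.
open Classical in
theorem card_sorted_by {U V : Type*} [Fintype U] [DecidableEq U] [Fintype V] [LinearOrder V]
    {N : ℕ} (hN : Fintype.card U = N) (u : U ↪ V) (s : Fin N ≃ U) :
    (Finset.card {π : Perm V | StrictMono (π ∘ u ∘ s)} : ℝ) =
      (Fintype.card V).factorial / N.factorial := by
  have hconst : ∀ t : Fin N ≃ U, (Finset.card {π : Perm V | StrictMono (π ∘ u ∘ t)} : ℝ) =
      Finset.card {π : Perm V | StrictMono (π ∘ u ∘ s)} := by
    intro t
    congr 1
    refine Finset.card_equiv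
      (Equiv.mulRight (Perm.viaFintypeEmbedding ((s.symm.trans t : Perm U)) u)) fun π => ?_
    simp only [Finset.mem_filter, Finset.mem_univ, true_and, Equiv.coe_mulRight]
    congr! 1
    ext i
    simp [Perm.viaFintypeEmbedding_apply_image]
  have hsum : ∑ t : Fin N ≃ U, (Finset.card {π : Perm V | StrictMono (π ∘ u ∘ t)} : ℝ) =
      (Fintype.card V).factorial := by
    simp only [Finset.card_filter, Nat.cast_sum, Nat.cast_ite, Nat.cast_one, Nat.cast_zero]
    have hone : ∀ π : Perm V, ∑ t : Fin N ≃ U,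
        (if StrictMono (π ∘ u ∘ t) then (1 : ℝ) else 0) = 1 := fun π =>
      sum_sorting hN (p := π ∘ u) (π.injective.comp u.injective)
    rw [Finset.sum_comm]
    simp [hone, Fintype.card_perm]
  rw [Finset.sum_congr rfl fun t _ => hconst t, Finset.sum_const, Finset.card_univ,
    Fintype.card_equiv s, Fintype.card_fin, nsmul_eq_mul] at hsum
  rw [← hsum, mul_div_cancel_left₀ _ (Nat.cast_ne_zero.2 N.factorial_ne_zero)]

/-- The product depends only on the relative orders `s` and `t` that `π₁` and `π₂` induce on the
labels, and each pair `(s, t)` is equally frequent. -/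
theorem sum_patternValue_mul_patternValue {D E V : Type*} [Fintype D] [Fintype E]
    [DecidableEq D] [DecidableEq E] [Fintype V] [LinearOrder V] {N : ℕ}
    (hN : Fintype.card (D ⊕ (E ⊕ E)) = N) (u : D ⊕ (E ⊕ E) ↪ V) (v : Perm (Fin k) → ℝ) :
    ∑ π₁ : Perm V, ∑ π₂ : Perm V,
      patternValue v (π₁ ∘ u ∘ Sum.map id Sum.inl) (π₂ ∘ u ∘ Sum.map id Sum.inl) *
      patternValue v (π₁ ∘ u ∘ Sum.map id Sum.inr) (π₂ ∘ u ∘ Sum.map id Sum.inr) =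
    ((Fintype.card V).factorial / N.factorial : ℝ) ^ 2 * overlapSum D E N v := by
  classical
  have hval : ∀ (π₁ π₂ : Perm V) (s t : Fin N ≃ D ⊕ (E ⊕ E)), StrictMono (π₁ ∘ u ∘ s) →
      StrictMono (π₂ ∘ u ∘ t) → ∀ j : D ⊕ E → D ⊕ (E ⊕ E),
      patternValue v (π₁ ∘ u ∘ j) (π₂ ∘ u ∘ j) = patternValue v (s.symm ∘ j) (t.symm ∘ j) := by
    intro π₁ π₂ s t hs ht j
    rw [← patternValue_strictMono_comp v (s.symm ∘ j) (t.symm ∘ j) hs ht]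
    congr 1 <;> ext i <;> simp
  have hone : ∀ π : Perm V, ∑ s : Fin N ≃ D ⊕ (E ⊕ E),
      (if StrictMono (π ∘ u ∘ s) then (1 : ℝ) else 0) = 1 := fun π =>
    sum_sorting hN (p := π ∘ u) (π.injective.comp u.injective)
  have hexp : ∀ π₁ π₂ : Perm V,
      patternValue v (π₁ ∘ u ∘ Sum.map id Sum.inl) (π₂ ∘ u ∘ Sum.map id Sum.inl) *
      patternValue v (π₁ ∘ u ∘ Sum.map id Sum.inr) (π₂ ∘ u ∘ Sum.map id Sum.inr) =
      ∑ s : Fin N ≃ D ⊕ (E ⊕ E), ∑ t : Fin N ≃ D ⊕ (E ⊕ E),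
      ((if StrictMono (π₁ ∘ u ∘ s) then (1 : ℝ) else 0) *
        (if StrictMono (π₂ ∘ u ∘ t) then (1 : ℝ) else 0)) *
      (patternValue v (s.symm ∘ Sum.map id Sum.inl) (t.symm ∘ Sum.map id Sum.inl) *
      patternValue v (s.symm ∘ Sum.map id Sum.inr) (t.symm ∘ Sum.map id Sum.inr)) := by
    intro π₁ π₂
    have hone' : (∑ s : Fin N ≃ D ⊕ (E ⊕ E), if StrictMono (π₁ ∘ u ∘ s) then (1 : ℝ) else 0) *
        (∑ t : Fin N ≃ D ⊕ (E ⊕ E), if StrictMono (π₂ ∘ u ∘ t) then (1 : ℝ) else 0) = 1 := by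
      rw [hone, hone, one_mul]
    refine (one_mul _).symm.trans ((congrArg (· * _) hone'.symm).trans ?_)
    rw [Finset.sum_mul_sum]
    simp only [Finset.sum_mul]
    refine Finset.sum_congr rfl fun s _ => Finset.sum_congr rfl fun t _ => ?_
    by_cases hs : StrictMono (π₁ ∘ u ∘ s) <;> by_cases ht : StrictMono (π₂ ∘ u ∘ t)
    · rw [hval π₁ π₂ s t hs ht, hval π₁ π₂ s t hs ht]
    all_goals simp [hs, ht]
  simp only [hexp, overlapSum]
  rw [← Fintype.sum_prod_type', Finset.sum_comm, Finset.mul_sum]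
  refine Finset.sum_congr rfl fun s _ => ?_
  rw [Finset.sum_comm, Finset.mul_sum]
  refine Finset.sum_congr rfl fun t _ => ?_
  rw [← Finset.sum_mul]
  congr 1
  rw [Fintype.sum_prod_type, sq]
  nth_rewrite 1 [← card_sorted_by hN u s]
  rw [← card_sorted_by hN u t]
  simp only [Finset.card_filter, Nat.cast_sum, Nat.cast_ite, Nat.cast_one, Nat.cast_zero,
    Finset.sum_mul_sum]

/-- `D` labels `A ∩ B`, and the two copies of `E` label `A \ B` and `B \ A`. -/
theorem sum_setValue_mul_setValue (v : Perm (Fin k) → ℝ) {A B : Finset (Fin n)} {m : ℕ}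
    (hA : A.card = k) (hB : B.card = k) (hm : (A ∩ B).card = m) :
    ∑ π₁ : Perm (Fin n), ∑ π₂ : Perm (Fin n), setValue v A π₁ π₂ * setValue v B π₁ π₂ =
    (n.factorial / (m + ((k - m) + (k - m))).factorial : ℝ) ^ 2 *
      overlapSum (Fin m) (Fin (k - m)) (m + ((k - m) + (k - m))) v := by
  have hAB : (A \ B).card = k - m := by rw [Finset.card_sdiff, Finset.inter_comm, hA, hm]
  have hBA : (B \ A).card = k - m := by rw [Finset.card_sdiff, hB, hm]
  let e₁ : Fin m ≃ ↥(A ∩ B) := (Finset.equivFinOfCardEq hm).symm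
  let e₂ : Fin (k - m) ≃ ↥(A \ B) := (Finset.equivFinOfCardEq hAB).symm
  let e₃ : Fin (k - m) ≃ ↥(B \ A) := (Finset.equivFinOfCardEq hBA).symm
  have h1 : ∀ x, (e₁ x : Fin n) ∈ A ∧ (e₁ x : Fin n) ∈ B := fun x =>
    Finset.mem_inter.1 (e₁ x).2
  have h2 : ∀ x, (e₂ x : Fin n) ∈ A ∧ (e₂ x : Fin n) ∉ B := fun x =>
    Finset.mem_sdiff.1 (e₂ x).2
  have h3 : ∀ x, (e₃ x : Fin n) ∈ B ∧ (e₃ x : Fin n) ∉ A := fun x =>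
    Finset.mem_sdiff.1 (e₃ x).2
  let u : Fin m ⊕ (Fin (k - m) ⊕ Fin (k - m)) ↪ Fin n :=
    ⟨Sum.elim (fun x => e₁ x) (Sum.elim (fun x => e₂ x) fun x => e₃ x), by
      refine (Subtype.val_injective.comp e₁.injective).sumElim
        ((Subtype.val_injective.comp e₂.injective).sumElim
          (Subtype.val_injective.comp e₃.injective) fun x y h => ?_) fun x y h => ?_
      · exact (h3 y).2 (h ▸ (h2 x).1)
      · obtain y | y := y
        · exact (h2 y).2 (by rw [← show (e₁ x : Fin n) = e₂ y from h]; exact (h1 x).2)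
        · exact (h3 y).2 (by rw [← show (e₁ x : Fin n) = e₃ y from h]; exact (h1 x).1)⟩
  let f : Fin m ⊕ Fin (k - m) → A := fun i => ⟨u (Sum.map id Sum.inl i), by
    obtain x | x := i
    exacts [(h1 x).1, (h2 x).1]⟩
  let g : Fin m ⊕ Fin (k - m) → B := fun i => ⟨u (Sum.map id Sum.inr i), by
    obtain x | x := i
    exacts [(h1 x).2, (h3 x).1]⟩
  have hf : Function.Bijective f := by
    constructor
    · intro i j hij
      exact Sum.map_injective.2 ⟨Function.injective_id, Sum.inl_injective⟩
        (u.injective (congrArg Subtype.val hij))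
    · rintro ⟨a, ha⟩
      by_cases hb : a ∈ B
      · exact ⟨Sum.inl (e₁.symm ⟨a, Finset.mem_inter.2 ⟨ha, hb⟩⟩), Subtype.ext (by simp [f, u])⟩
      · exact ⟨Sum.inr (e₂.symm ⟨a, Finset.mem_sdiff.2 ⟨ha, hb⟩⟩), Subtype.ext (by simp [f, u])⟩
  have hg : Function.Bijective g := by
    constructor
    · intro i j hij
      exact Sum.map_injective.2 ⟨Function.injective_id, Sum.inr_injective⟩
        (u.injective (congrArg Subtype.val hij))
    · rintro ⟨b, hb⟩
      by_cases ha : b ∈ A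
      · exact ⟨Sum.inl (e₁.symm ⟨b, Finset.mem_inter.2 ⟨ha, hb⟩⟩), Subtype.ext (by simp [g, u])⟩
      · exact ⟨Sum.inr (e₃.symm ⟨b, Finset.mem_sdiff.2 ⟨hb, ha⟩⟩), Subtype.ext (by simp [g, u])⟩
  have key := sum_patternValue_mul_patternValue
    (N := m + ((k - m) + (k - m))) (by simp) u v
  rw [Fintype.card_fin] at key
  rw [← key]
  refine Finset.sum_congr rfl fun π₁ _ => Finset.sum_congr rfl fun π₂ _ => ?_
  rw [setValue, setValue, ← patternValue_comp_equiv v _ _ (Equiv.ofBijective f hf),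
    ← patternValue_comp_equiv v _ _ (Equiv.ofBijective g hg)]
  rfl

theorem card_filter_inter_card {α : Type*} [Fintype α] [DecidableEq α] (A : Finset α) (m : ℕ)
    (hm : m ≤ k) :
    ((Finset.powersetCard k Finset.univ).filter fun B => (A ∩ B).card = m).card =
      A.card.choose m * (Fintype.card α - A.card).choose (k - m) := by
  rw [← Finset.card_compl, ← Finset.card_powersetCard, ← Finset.card_powersetCard,
    ← Finset.card_product]
  refine Finset.card_nbij' (fun B => (A ∩ B, B \ A)) (fun P => P.1 ∪ P.2) ?_ ?_ ?_ ?_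
  · intro B hB
    simp only [Finset.coe_filter, Finset.mem_powersetCard, Set.mem_ofPred_eq] at hB
    simp only [Finset.coe_product, Set.mem_prod, Finset.mem_coe, Finset.mem_powersetCard]
    refine ⟨⟨Finset.inter_subset_left, hB.2⟩, fun x hx => ?_, ?_⟩
    · simp at hx ⊢; exact hx.2
    · rw [Finset.card_sdiff, hB.1.2, hB.2]
  · rintro ⟨P, Q⟩ hP
    simp only [Finset.coe_product, Set.mem_prod, Finset.mem_coe, Finset.mem_powersetCard] at hP
    obtain ⟨⟨hP, hPm⟩, hQ, hQm⟩ := hP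
    have hAQ : Disjoint A Q := Finset.disjoint_left.2 fun x hx hx' => by simpa [hx] using hQ hx'
    simp only [Finset.coe_filter, Finset.mem_powersetCard, Set.mem_ofPred_eq]
    refine ⟨⟨Finset.subset_univ _, ?_⟩, ?_⟩
    · rw [Finset.card_union_of_disjoint (hAQ.mono_left hP)]; omega
    · rw [Finset.inter_union_distrib_left, Finset.inter_eq_right.2 hP,
        Finset.disjoint_iff_inter_eq_empty.1 hAQ, Finset.union_empty, hPm]
  · intro B _
    ext x; simp; tauto
  · rintro ⟨P, Q⟩ hP
    simp only [Finset.coe_product, Set.mem_prod, Finset.mem_coe, Finset.mem_powersetCard] at hP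
    obtain ⟨⟨hP, hPm⟩, hQ, hQm⟩ := hP
    have hP' : ∀ x ∈ P, x ∈ A := fun x hx => hP hx
    have hQ' : ∀ x ∈ Q, x ∉ A := fun x hx => by simpa using hQ hx
    ext x
    · simp only [Finset.mem_inter, Finset.mem_union]; grind
    · simp only [Finset.mem_sdiff, Finset.mem_union]; grind

theorem sum_powersetCard_inter_card (g : ℕ → ℝ) (n : ℕ) :
    ∑ A ∈ Finset.powersetCard k (Finset.univ : Finset (Fin n)),
      ∑ B ∈ Finset.powersetCard k (Finset.univ : Finset (Fin n)), g (A ∩ B).card =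
    n.choose k * ∑ m ∈ Finset.range (k + 1), (k.choose m * (n - k).choose (k - m) : ℕ) * g m := by
  have h : ∀ A ∈ Finset.powersetCard k (Finset.univ : Finset (Fin n)),
      ∑ B ∈ Finset.powersetCard k (Finset.univ : Finset (Fin n)), g (A ∩ B).card =
      ∑ m ∈ Finset.range (k + 1), (k.choose m * (n - k).choose (k - m) : ℕ) * g m := by
    intro A hA
    have hA := (Finset.mem_powersetCard.1 hA).2
    rw [← Finset.sum_fiberwise_of_maps_to (g := fun B => (A ∩ B).card)
      (t := Finset.range (k + 1))]
    · refine Finset.sum_congr rfl fun m hm => ?_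
      rw [Finset.sum_congr rfl fun B hB => by rw [(Finset.mem_filter.1 hB).2], Finset.sum_const,
        card_filter_inter_card A m (by simpa [Nat.lt_succ_iff] using hm), hA, Fintype.card_fin,
        nsmul_eq_mul]
    · intro B _
      rw [Finset.mem_range, Nat.lt_succ_iff, ← hA]
      exact Finset.card_le_card Finset.inter_subset_left
  rw [Finset.sum_congr rfl h, Finset.sum_const, Finset.card_powersetCard, Finset.card_univ,
    Fintype.card_fin, nsmul_eq_mul]

/-- The expected product of the values of `v` at the patterns of two `k`-sets with `m` common
elements. -/
noncomputable def overlapMoment (v : Perm (Fin k) → ℝ) (m : ℕ) : ℝ :=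
  overlapSum (Fin m) (Fin (k - m)) (m + ((k - m) + (k - m))) v /
    ((m + ((k - m) + (k - m))).factorial : ℝ) ^ 2

theorem secondMoment_eq (v : Perm (Fin k) → ℝ) (hkn : k ≤ n) :
    secondMoment v n = ∑ m ∈ Finset.range (k + 1),
      overlapMoment v m * k.choose m * ((n - k).choose (k - m) / n.choose k) := by
  have h1 : ∀ π : Perm (Fin n), ∑ σ, v σ * profile k π σ =
      (∑ A ∈ Finset.powersetCard k Finset.univ, setValue v A 1 π) / n.choose k := by
    intro π
    rw [← sum_mul_patternCount, Finset.sum_div]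
    exact Finset.sum_congr rfl fun σ _ => by rw [profile, mul_div_assoc]
  have hn : (n.factorial : ℝ) ≠ 0 := Nat.cast_ne_zero.2 n.factorial_ne_zero
  have hc : (n.choose k : ℝ) ≠ 0 := Nat.cast_ne_zero.2 (Nat.choose_pos hkn).ne'
  have h2 := sum_sq_sum_setValue v n
  have h3 : ∑ A ∈ Finset.powersetCard k (Finset.univ : Finset (Fin n)),
      ∑ B ∈ Finset.powersetCard k (Finset.univ : Finset (Fin n)),
      ∑ π₁ : Perm (Fin n), ∑ π₂ : Perm (Fin n), setValue v A π₁ π₂ * setValue v B π₁ π₂ =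
      ∑ A ∈ Finset.powersetCard k (Finset.univ : Finset (Fin n)),
      ∑ B ∈ Finset.powersetCard k (Finset.univ : Finset (Fin n)),
      (n.factorial : ℝ) ^ 2 * overlapMoment v (A ∩ B).card :=
    Finset.sum_congr rfl fun A hA => Finset.sum_congr rfl fun B hB => by
      rw [sum_setValue_mul_setValue v (Finset.mem_powersetCard.1 hA).2
        (Finset.mem_powersetCard.1 hB).2 rfl, overlapMoment]
      ring
  rw [h3, sum_powersetCard_inter_card (fun m => (n.factorial : ℝ) ^ 2 * overlapMoment v m)] at h2
  have h4 : ∑ π : Perm (Fin n),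
      (∑ A ∈ Finset.powersetCard k Finset.univ, setValue v A 1 π) ^ 2 =
      n.factorial * (n.choose k * ∑ m ∈ Finset.range (k + 1),
        (k.choose m * (n - k).choose (k - m) : ℕ) * overlapMoment v m) := by
    apply mul_left_cancel₀ hn
    rw [h2]
    simp only [Finset.mul_sum]
    exact Finset.sum_congr rfl fun m _ => by ring
  simp only [secondMoment, h1, div_pow]
  rw [← Finset.sum_div, h4]
  rw [div_div, div_eq_iff (by positivity), Finset.mul_sum, Finset.mul_sum, Finset.sum_mul]
  refine Finset.sum_congr rfl fun m _ => ?_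
  push_cast
  field_simp

end Sorting

/-! ### Asymptotics of the overlap probabilities. -/

section Asymptotics

open Filter Asymptotics Topology

theorem isEquivalent_choose_sub_div_choose {k m : ℕ} (hm : m ≤ k) :
    (fun n : ℕ => ((n - k).choose (k - m) / n.choose k : ℝ)) ~[atTop]
      fun n : ℕ => (k.factorial / (k - m).factorial : ℝ) / (n : ℝ) ^ m := by
  have h0 : (fun n : ℕ => ((n - k : ℕ) : ℝ)) ~[atTop] fun n : ℕ => (n : ℝ) := by
    refine isEquivalent_of_tendsto_one ?_
    rw [← tendsto_add_atTop_iff_nat k]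
    simpa using tendsto_natCast_div_add_atTop (k : ℝ)
  have h1 : (fun n : ℕ => ((n - k).choose (k - m) : ℝ)) ~[atTop]
      fun n : ℕ => (n : ℝ) ^ (k - m) / (k - m).factorial :=
    ((isEquivalent_choose (k - m)).comp_tendsto (tendsto_sub_atTop_nat k)).trans
      ((h0.pow (k - m)).div IsEquivalent.refl)
  refine (h1.div (isEquivalent_choose k)).congr_right ?_
  filter_upwards [eventually_ne_atTop 0] with n hn
  have hn : (n : ℝ) ≠ 0 := Nat.cast_ne_zero.2 hn
  have hk : (k.factorial : ℝ) ≠ 0 := Nat.cast_ne_zero.2 k.factorial_ne_zero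
  have hkm : ((k - m).factorial : ℝ) ≠ 0 := Nat.cast_ne_zero.2 (k - m).factorial_ne_zero
  simp only [Pi.div_apply]
  rw [show (n : ℝ) ^ k = (n : ℝ) ^ (k - m) * (n : ℝ) ^ m by
    rw [← pow_add, Nat.sub_add_cancel hm]]
  field_simp

theorem tendsto_choose_sub_div_choose_mul_pow {k m r : ℕ} (hm : m ≤ k) (hr : r ≤ m) :
    Tendsto (fun n : ℕ => ((n - k).choose (k - m) / n.choose k : ℝ) * (n : ℝ) ^ r) atTop
      (𝓝 (if m = r then (k.factorial / (k - m).factorial : ℝ) else 0)) := by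
  have h : Tendsto (fun n : ℕ => (k.factorial / (k - m).factorial : ℝ) *
      ((n : ℝ)⁻¹) ^ (m - r)) atTop
      (𝓝 (if m = r then (k.factorial / (k - m).factorial : ℝ) else 0)) := by
    convert (tendsto_inv_atTop_nhds_zero_nat (𝕜 := ℝ)).pow (m - r) |>.const_mul _ using 2
    split_ifs with hmr
    · simp [hmr]
    · rw [zero_pow (by omega), mul_zero]
  refine IsEquivalent.tendsto_nhds (IsEquivalent.symm ?_) h
  refine ((isEquivalent_choose_sub_div_choose hm).mul
    (IsEquivalent.refl (u := fun n : ℕ => (n : ℝ) ^ r))).congr_right ?_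
  filter_upwards [eventually_ne_atTop 0] with n hn
  have hn : (n : ℝ) ≠ 0 := Nat.cast_ne_zero.2 hn
  simp only [Pi.mul_apply]
  rw [show (n : ℝ) ^ m = (n : ℝ) ^ (m - r) * (n : ℝ) ^ r by
    rw [← pow_add, Nat.sub_add_cancel hr], inv_pow]
  field_simp

theorem overlapMoment_eq_zero {k r m : ℕ} {v : Perm (Fin k) → ℝ} (hv : v ∈ component k r)
    (hm : m < r) (hmk : m ≤ k) : overlapMoment v m = 0 := by
  rw [overlapMoment, overlapSum_eq_zero (by simp) fun α β =>
    cosetSum_eq_zero_of_mem_component hv (by simpa using Nat.add_sub_cancel' hmk) (by simpa) α β,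
    zero_div]

theorem overlapMoment_pos {k r : ℕ} {v : Perm (Fin k) → ℝ} (hv : v ∈ component k r)
    (hv0 : v ≠ 0) (hr : r ≤ k) : 0 < overlapMoment v r := by
  obtain ⟨α, β, h⟩ := exists_cosetSum_ne_zero (D := Fin r) (E := Fin (k - r)) hv hv0
    (by simpa using Nat.add_sub_cancel' hr) (by simp)
  have := overlapSum_pos (N := r + ((k - r) + (k - r))) (by simp) h
  rw [overlapMoment]
  positivity

/-- After scaling by `n ^ r`, overlaps `m < r` contribute exactly zero and overlaps `m > r` tend to
zero, so only `m = r` survives. -/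
theorem tendsto_secondMoment_mul_pow {k r : ℕ} {v : Perm (Fin k) → ℝ} (hv : v ∈ component k r)
    (hr : r ≤ k) :
    Tendsto (fun n : ℕ => secondMoment v n * (n : ℝ) ^ r) atTop
      (𝓝 (overlapMoment v r * k.choose r * (k.factorial / (k - r).factorial))) := by
  have h : Tendsto (fun n : ℕ => ∑ m ∈ Finset.range (k + 1), overlapMoment v m * k.choose m *
      (((n - k).choose (k - m) / n.choose k : ℝ) * (n : ℝ) ^ r)) atTop
      (𝓝 (∑ m ∈ Finset.range (k + 1), overlapMoment v m * k.choose m *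
        (if m = r then (k.factorial / (k - m).factorial : ℝ) else 0))) := by
    refine tendsto_finsetSum _ fun m hm => ?_
    have hm : m ≤ k := by simpa [Nat.lt_succ_iff] using hm
    rcases lt_or_ge m r with hmr | hmr
    · simp [overlapMoment_eq_zero hv hmr hm]
    · exact (tendsto_choose_sub_div_choose_mul_pow hm hmr).const_mul _
  simp only [mul_ite, mul_zero, Finset.sum_ite_eq', Finset.mem_range, Nat.lt_succ_iff, hr,
    if_true] at h
  refine h.congr' ?_
  filter_upwards [eventually_ge_atTop k] with n hn
  rw [secondMoment_eq v hn, Finset.sum_mul]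
  exact Finset.sum_congr rfl fun m _ => by ring

end Asymptotics

end PermProfile

theorem theorem1 (k r : ℕ) (hr : r < k) (v : Equiv.Perm (Fin k) → ℝ)
    (hv : v ∈ PermProfile.component k r) (hv0 : v ≠ 0) :
    ∃ C : ℝ, 0 < C ∧
      Asymptotics.IsEquivalent Filter.atTop
        (fun n : ℕ => PermProfile.secondMoment v n) (fun n : ℕ => C / (n : ℝ) ^ r) := by
  have hC : 0 < PermProfile.overlapMoment v r * k.choose r *
      (k.factorial / (k - r).factorial) := by
    have h1 := PermProfile.overlapMoment_pos hv hv0 hr.le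
    have h2 : 0 < k.choose r := Nat.choose_pos hr.le
    positivity
  refine ⟨_, hC, Asymptotics.isEquivalent_of_tendsto_one ?_⟩
  have h := (PermProfile.tendsto_secondMoment_mul_pow hv hr.le).div_const
    (PermProfile.overlapMoment v r * k.choose r * (k.factorial / (k - r).factorial))
  rw [div_self hC.ne'] at h
  refine h.congr fun n => ?_
  simp only [Pi.div_apply, div_div_eq_mul_div]
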